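/- Conventions. All lattices have a least element $0$ and a greatest element $1$ (possibly $0=1$), and lattice homomorphisms preserve $0$ and $1$. A bitopological space $(S,\mathcal T^+,\mathcal T^-)$ is a set with two topologies; put $\mathcal L^{\pm}=\{U\in\mathcal T^{\pm}: S\setminus U\in\mathcal T^{\mp}\}$. A non-empty bitopological space is an abstract spectrum if $\mathcal L^+$ is a base of $\mathcal T^+$ and $\mathcal L^-$ is a base of $\mathcal T^-$; every $\mathcal T^+$-closed set is $\mathcal T^-$-compact and every $\mathcal T^-$-closed set is $\mathcal T^+$-compact; and at least one of $\mathcal T^+,\mathcal T^-$ is $T_0$. An $\mathbf S$-morphism is a map that is continuous for both the $\mathcal T^+$ and the $\mathcal T^-$ topologies; an $\mathbf S$-isomorphism is a bijective $\mathbf S$-morphism whose inverse is an $\mathbf S$-morphism (these two terms are also used for empty spaces). A family $S$ of subsets of a set $X$ is given the topology $\mathcal T^+$ with subbase $\{p\in S: x\notin p\}$, $x\in X$, and the topology $\mathcal T^-$ with subbase $\{p\in S: x\in p\}$, $x\in X$. For a distributive lattice $L$, $\operatorname{spec}(L)$ is the set of its (proper, non-empty) prime ideals with these two topologies ($\mathcal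 T^+$ is the Stone topology). Statement. Let $X$ be a set with two arbitrary (single-valued) binary operations $+,\times$ and two different points $\xi_0,\xi_1\in X$. A subset $p\subseteq X$ is an l-prime ideal if for all $x,y\in X$: $x+y\in p$ iff $x\in p$ and $y\in p$; and $x\times y\in p$ iff $x\in p$ or $y\in p$. It is proper if moreover $\xi_0\in p$ and $\xi_1\notin p$. Let $S$ be either the set of all l-prime ideals of $X$ or the set of all proper l-prime ideals of $X$. Then there are a distributive lattice $L$ with $0$ and $1$ and a function $\varphi:X\to L$ such that: (i) $\varphi(X)$ generates $L$ as a lattice with $0$ and $1$ (the only sublattice of $L$ containing $\varphi(X)$, $0$ and $1$ is $L$); (ii) $\varphi^{-1}(q)\in S$ for every $q\in\operatorname{spec}(L)$; (iii) $\Phi:\operatorname{spec}(L)\to S$, $q\mapsto\varphi^{-1}(q)$, is an $\mathbf S$-isomorphism, where $S$ and $\operatorname{spec}(L)$ are abstract spectra whenever $S\neq\emptyset$; (iv) if $L'$ is a distributive lattice with $0$ and $1$ and $\theta:X\to L'$ is a function such that $\theta^{-1}(q)\in S$ for every $q\in\operatorname{spec}(L')$ and $\Theta:\operatorname{spec}(L')\to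 S$, $q\mapsto\theta^{-1}(q)$, is an $\mathbf S$-morphism, then there is a unique lattice homomorphism $l:L\to L'$ with $l\circ\varphi=\theta$; (v) if $L_1$ is a distributive lattice with $0$ and $1$ and $\varphi_1:X\to L_1$ is a function such that $\varphi_1^{-1}(q)\in S$ for every $q\in\operatorname{spec}(L_1)$ and $\Phi_1:\operatorname{spec}(L_1)\to S$, $q\mapsto\varphi_1^{-1}(q)$, is an $\mathbf S$-isomorphism, then there is a unique lattice isomorphism $l:L\to L_1$ with $l\circ\varphi=\varphi_1$; (vi) $\varphi(a+b)=\varphi(a)\vee\varphi(b)$ and $\varphi(a\times b)=\varphi(a)\wedge\varphi(b)$ for all $a,b\in X$. -/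

import Mathlib

universe u v

namespace AbstractSpectra

open scoped Topology

/-- A bitopology on a set: an ordered pair of topologies `(𝒯⁺, 𝒯⁻)`. -/
structure Bitopology (S : Type*) where
  pos : TopologicalSpace S
  neg : TopologicalSpace S

/-- `ℒ⁺`: the `𝒯⁺`-open sets whose complement is `𝒯⁻`-open. -/
def Bitopology.posLattice {S : Type*} (B : Bitopology S) : Set (Set S) :=
  {U | IsOpen[B.pos] U ∧ IsOpen[B.neg] Uᶜ}

/-- `ℒ⁻`: the `𝒯⁻`-open sets whose complement is `𝒯⁺`-open. -/
def Bitopology.negLattice {S : Type*} (B : Bitopology S) : Set (Set S) :=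
  {U | IsOpen[B.neg] U ∧ IsOpen[B.pos] Uᶜ}

/-- Abstract spectra. -/
structure IsAbstractSpectrum {S : Type*} (B : Bitopology S) : Prop where
  nonempty : Nonempty S
  basis_pos : @TopologicalSpace.IsTopologicalBasis S B.pos B.posLattice
  basis_neg : @TopologicalSpace.IsTopologicalBasis S B.neg B.negLattice
  compact_neg : ∀ F : Set S, IsOpen[B.pos] Fᶜ → @IsCompact S B.neg F
  compact_pos : ∀ F : Set S, IsOpen[B.neg] Fᶜ → @IsCompact S B.pos F
  t0 : @T0Space S B.pos ∨ @T0Space S B.neg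

/-- Morphisms: maps continuous for the two first and for the two second topologies. -/
def IsSpectralMorphism {S T : Type*} (B : Bitopology S) (C : Bitopology T) (f : S → T) : Prop :=
  @Continuous S T B.pos C.pos f ∧ @Continuous S T B.neg C.neg f

/-- Isomorphisms: morphisms with a two-sided inverse that is a morphism. -/
def IsSpectralIso {S T : Type*} (B : Bitopology S) (C : Bitopology T) (f : S → T) : Prop :=
  IsSpectralMorphism B C f ∧
    ∃ g : T → S, IsSpectralMorphism C B g ∧ Function.LeftInverse g f ∧ Function.RightInverse g f

/-- The canonical bitopology of a family `S` of subsets of `X`: `𝒯⁺` has the subbase of all sets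
`{p ∈ S | x ∉ p}`, and `𝒯⁻` has the subbase of all sets `{p ∈ S | x ∈ p}`, for `x ∈ X`. -/
def familyBitopology {X : Type*} (S : Set (Set X)) : Bitopology S where
  pos := TopologicalSpace.generateFrom (Set.range fun x : X => {p : S | x ∉ (p : Set X)})
  neg := TopologicalSpace.generateFrom (Set.range fun x : X => {p : S | x ∈ (p : Set X)})

/-- `spec L`: the family of all prime ideals of `L`. As an abstract spectrum it carries
`familyBitopology (spec L)`; here `𝒯⁺` is the Stone topology. -/
def spec (L : Type*) [DistribLattice L] [BoundedOrder L] : Set (Set L) :=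
  {q | ∃ I : Order.Ideal L, I.IsPrime ∧ (I : Set L) = q}

/-- `S'(X)`: the family of all l-prime ideals of `(X, +, ×)`. -/
def lPrimeIdeals {X : Type*} (add mul : X → X → X) : Set (Set X) :=
  {p | (∀ x y, add x y ∈ p ↔ x ∈ p ∧ y ∈ p) ∧ (∀ x y, mul x y ∈ p ↔ x ∈ p ∨ y ∈ p)}

/-- `S'(X)_pr`: the family of all l-prime ideals that contain `ξ₀` and do not contain `ξ₁`. -/
def properLPrimeIdeals {X : Type*} (add mul : X → X → X) (ξ₀ ξ₁ : X) : Set (Set X) :=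
  {p | p ∈ lPrimeIdeals add mul ∧ ξ₀ ∈ p ∧ ξ₁ ∉ p}

/-- The map `spec L → S`, `q ↦ θ⁻¹(q)`. -/
def pullback {X L : Type*} [DistribLattice L] [BoundedOrder L] {S : Set (Set X)} (θ : X → L)
    (h : ∀ q ∈ spec L, θ ⁻¹' q ∈ S) (q : spec L) : S :=
  ⟨θ ⁻¹' (q : Set L), h q q.2⟩

/-- `A` generates `L` as a lattice with `0` and `1`: the only sublattice of `L` that contains
`A`, `0` and `1` is `L` itself. -/
def Generates {L : Type*} [DistribLattice L] [BoundedOrder L] (A : Set L) : Prop :=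
  ∀ M : Sublattice L, A ⊆ (M : Set L) → ⊥ ∈ M → ⊤ ∈ M → M = ⊤

end AbstractSpectra

open AbstractSpectra

/-! Take for `L` the lattice of subsets of `S` generated by the sets `{p ∈ S | x ∉ p}`, and for `φ
x` that set. A point `p` of `S` gives the prime ideal of all members of `L` missing `p`. A prime
ideal is determined by its trace on generators, so `Φ` is bijective once it lands in `S`, which
follows from (vi). For (iv), each `a` in `L` has a counterpart in `L'` lying outside `q` exactly
when `θ⁻¹(q) ∈ a`. The prime ideal theorem makes it unique, so it depends on `a` homomorphically.
For (v), injectivity uses that `Φ₁` is onto. Surjectivity uses compactness: `S` is closed in the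
Cantor cube, hence `ℒ⁺` is exactly `L` (`IsUltraClosed.isGenerated`). -/

namespace AbstractSpectra

open scoped Topology

/-! ### Bitopologies of families of sets, and compactness. -/

section Families

variable {X : Type*}

/-- The basic `𝒯⁺`-open set `{p ∈ S | x ∉ p}`. -/
def basicSet (S : Set (Set X)) (x : X) : Set S := {p | x ∉ (p : Set X)}

/-- The members of the lattice of sets generated by the basic sets, `∅` and `univ`. -/
inductive IsGenerated (S : Set (Set X)) : Set S → Prop
  | basic (x : X) : IsGenerated S (basicSet S x)
  | bot : IsGenerated S ⊥
  | top : IsGenerated S ⊤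
  | sup {a b : Set S} : IsGenerated S a → IsGenerated S b → IsGenerated S (a ⊔ b)
  | inf {a b : Set S} : IsGenerated S a → IsGenerated S b → IsGenerated S (a ⊓ b)

/-- The lattice of subsets of `S` generated by the basic sets, `∅` and `univ`. -/
def basicLattice (S : Set (Set X)) : Sublattice (Set S) where
  carrier := {a | IsGenerated S a}
  supClosed' := fun _ ha _ hb => ha.sup hb
  infClosed' := fun _ ha _ hb => ha.inf hb

instance (S : Set (Set X)) : BoundedOrder (basicLattice S) where
  top := ⟨⊤, .top⟩
  le_top a := le_top (a := (a : Set S))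
  bot := ⟨⊥, .bot⟩
  bot_le a := bot_le (a := (a : Set S))

/-- The canonical map from `X` to the lattice generated by the basic sets. -/
def toBasicLattice (S : Set (Set X)) (x : X) : basicLattice S := ⟨basicSet S x, .basic x⟩

theorem generates_range_toBasicLattice (S : Set (Set X)) :
    Generates (Set.range (toBasicLattice S)) := by
  intro M hM hbot htop
  refine top_le_iff.1 fun a _ => ?_
  obtain ⟨a, ha⟩ := a
  change IsGenerated S a at ha
  induction ha with
  | basic x => exact hM ⟨x, rfl⟩
  | bot => exact hbot
  | top => exact htop
  | sup ha hb iha ihb => exact M.supClosed (iha trivial) (ihb trivial)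
  | inf ha hb iha ihb => exact M.infClosed (iha trivial) (ihb trivial)

theorem IsGenerated.isOpen_pos {S : Set (Set X)} {a : Set S} (ha : IsGenerated S a) :
    IsOpen[(familyBitopology S).pos] a := by
  let _ := (familyBitopology S).pos
  change IsOpen a
  induction ha with
  | basic x => exact TopologicalSpace.isOpen_generateFrom_of_mem ⟨x, rfl⟩
  | bot => exact isOpen_empty
  | top => exact isOpen_univ
  | sup _ _ iha ihb => exact iha.union ihb
  | inf _ _ iha ihb => exact iha.inter ihb

theorem IsGenerated.isOpen_neg_compl {S : Set (Set X)} {a : Set S} (ha : IsGenerated S a) :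
    IsOpen[(familyBitopology S).neg] aᶜ := by
  let _ := (familyBitopology S).neg
  change IsOpen aᶜ
  induction ha with
  | basic x =>
    refine TopologicalSpace.isOpen_generateFrom_of_mem ⟨x, ?_⟩
    ext p
    simp [basicSet]
  | bot => simp
  | top => simp
  | sup _ _ iha ihb => simpa [Set.compl_union] using iha.inter ihb
  | inf _ _ iha ihb => simpa [Set.compl_inter] using iha.union ihb

theorem isTopologicalBasis_isGenerated (S : Set (Set X)) :
    @TopologicalSpace.IsTopologicalBasis S (familyBitopology S).pos {a | IsGenerated S a} := by
  let _ := (familyBitopology S).pos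
  refine ⟨fun a ha b hb p hp => ⟨a ∩ b, ha.inf hb, hp, subset_rfl⟩,
    Set.sUnion_eq_univ_iff.2 fun p => ⟨_, .top, trivial⟩, le_antisymm ?_ ?_⟩
  · exact le_generateFrom fun a ha => IsGenerated.isOpen_pos ha
  · refine TopologicalSpace.generateFrom_anti ?_
    rintro _ ⟨x, rfl⟩
    exact .basic x

theorem isTopologicalBasis_isGenerated_compl (S : Set (Set X)) :
    @TopologicalSpace.IsTopologicalBasis S (familyBitopology S).neg {a | IsGenerated S aᶜ} := by
  let _ := (familyBitopology S).neg
  refine ⟨fun a ha b hb p hp => ⟨a ∩ b, ?_, hp, subset_rfl⟩,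
    Set.sUnion_eq_univ_iff.2 fun p => ⟨Set.univ, ?_, trivial⟩, le_antisymm ?_ ?_⟩
  · simpa [Set.compl_inter] using IsGenerated.sup ha hb
  · simpa using IsGenerated.bot (S := S)
  · exact le_generateFrom fun a ha => by simpa using IsGenerated.isOpen_neg_compl ha
  · refine TopologicalSpace.generateFrom_anti ?_
    rintro _ ⟨x, rfl⟩
    exact .basic x

/-- The limit of an ultrafilter of subsets of `X`. -/
def ultraLimit (F : Ultrafilter (Set X)) : Set X := {x | {p | x ∈ p} ∈ F}

/-- A family of sets that contains the limits of all ultrafilters on it; equivalently, a closed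
subset of the Cantor cube `2 ^ X`. -/
def IsUltraClosed (S : Set (Set X)) : Prop :=
  ∀ F : Ultrafilter (Set X), S ∈ F → ultraLimit F ∈ S

/-- The ultrafilter itself decides which `x` belong to its limit, so it contains every subbasic
neighbourhood of the limit, of either kind. That one point serves both topologies is what yields
compactness below. -/
theorem IsUltraClosed.exists_le_nhds {S : Set (Set X)} (hS : IsUltraClosed S)
    (F : Ultrafilter S) : ∃ p : S, ↑F ≤ @nhds S (familyBitopology S).pos p ∧
      ↑F ≤ @nhds S (familyBitopology S).neg p := by
  have hF : S ∈ F.map Subtype.val :=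
    Ultrafilter.mem_map.2 (Filter.mem_of_superset Filter.univ_mem fun p _ => p.2)
  refine ⟨⟨ultraLimit (F.map Subtype.val), hS _ hF⟩, ?_, ?_⟩
  · rw [familyBitopology, TopologicalSpace.nhds_generateFrom]
    refine le_iInf₂ fun s hs => Filter.le_principal_iff.2 ?_
    obtain ⟨hp, x, rfl⟩ := hs
    exact Ultrafilter.compl_mem_iff_notMem.2 hp
  · rw [familyBitopology, TopologicalSpace.nhds_generateFrom]
    refine le_iInf₂ fun s hs => Filter.le_principal_iff.2 ?_
    obtain ⟨hp, x, rfl⟩ := hs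
    exact hp

/-- The `𝒯⁻`-limit of an ultrafilter on `K` stays in the `𝒯⁻`-closed set `K`, and it is also a
`𝒯⁺`-limit. -/
theorem IsUltraClosed.isCompact_pos {S : Set (Set X)} (hS : IsUltraClosed S) {K : Set S}
    (hK : IsOpen[(familyBitopology S).neg] Kᶜ) : @IsCompact S (familyBitopology S).pos K := by
  rw [@isCompact_iff_ultrafilter_le_nhds]
  intro F hF
  obtain ⟨p, hpos, hneg⟩ := hS.exists_le_nhds F
  refine ⟨p, by_contra fun hp => ?_, hpos⟩
  exact Ultrafilter.compl_mem_iff_notMem.1 (hneg (@IsOpen.mem_nhds S (familyBitopology S).neg p Kᶜ hK hp))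
    (Filter.le_principal_iff.1 hF)

theorem IsUltraClosed.isCompact_neg {S : Set (Set X)} (hS : IsUltraClosed S) {K : Set S}
    (hK : IsOpen[(familyBitopology S).pos] Kᶜ) : @IsCompact S (familyBitopology S).neg K := by
  rw [@isCompact_iff_ultrafilter_le_nhds]
  intro F hF
  obtain ⟨p, hpos, hneg⟩ := hS.exists_le_nhds F
  refine ⟨p, by_contra fun hp => ?_, hneg⟩
  exact Ultrafilter.compl_mem_iff_notMem.1 (hpos (@IsOpen.mem_nhds S (familyBitopology S).pos p Kᶜ hK hp))
    (Filter.le_principal_iff.1 hF)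

theorem t0Space_pos (S : Set (Set X)) : @T0Space S (familyBitopology S).pos := by
  let _ := (familyBitopology S).pos
  refine ⟨fun p q hpq => Subtype.ext (Set.ext fun x => not_iff_not.1 ?_)⟩
  exact hpq.mem_open_iff (IsGenerated.basic (S := S) x).isOpen_pos

theorem IsUltraClosed.isAbstractSpectrum {S : Set (Set X)} (hS : IsUltraClosed S)
    (hne : S.Nonempty) : IsAbstractSpectrum (familyBitopology S) where
  nonempty := hne.to_subtype
  basis_pos := by
    let _ := (familyBitopology S).pos
    exact (isTopologicalBasis_isGenerated S).of_isOpen_of_subset (fun _ ha => ha.1)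
      fun a ha => ⟨IsGenerated.isOpen_pos ha, IsGenerated.isOpen_neg_compl ha⟩
  basis_neg := by
    let _ := (familyBitopology S).neg
    exact (isTopologicalBasis_isGenerated_compl S).of_isOpen_of_subset (fun _ ha => ha.1)
      fun a ha => ⟨by simpa using IsGenerated.isOpen_neg_compl ha, IsGenerated.isOpen_pos ha⟩
  compact_neg _ := hS.isCompact_neg
  compact_pos _ := hS.isCompact_pos
  t0 := .inl (t0Space_pos S)

/-- Over an ultraclosed family, `ℒ⁺` is the lattice generated by the basic sets. -/
theorem IsUltraClosed.isGenerated {S : Set (Set X)} (hS : IsUltraClosed S) {a : Set S}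
    (ha : a ∈ (familyBitopology S).posLattice) : IsGenerated S a := by
  let _ := (familyBitopology S).pos
  have hc : IsCompact a := hS.isCompact_pos ha.2
  obtain ⟨b, hb, hab, hba⟩ : ∃ b, IsGenerated S b ∧ a ⊆ b ∧ b ⊆ a := by
    -- Having a generated set between `s` and `a` is inherited by subsets and finite unions, and
    -- holds locally since generated sets form a base.
    refine hc.induction_on (p := fun s => ∃ b, IsGenerated S b ∧ s ⊆ b ∧ b ⊆ a)
      ⟨⊥, .bot, subset_rfl, Set.empty_subset _⟩ ?_ ?_ fun p hp => ?_
    · rintro s t hst ⟨b, hb, htb, hba⟩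
      exact ⟨b, hb, hst.trans htb, hba⟩
    · rintro s t ⟨b, hb, hsb, hba⟩ ⟨c, hc, htc, hca⟩
      exact ⟨b ⊔ c, hb.sup hc, Set.union_subset_union hsb htc, Set.union_subset hba hca⟩
    · obtain ⟨b, hb, hpb, hba⟩ :=
        (isTopologicalBasis_isGenerated S).exists_subset_of_mem_open hp ha.1
      exact ⟨b, mem_nhdsWithin_of_mem_nhds (hb.isOpen_pos.mem_nhds hpb), b, hb, subset_rfl, hba⟩
  rwa [hab.antisymm hba]

end Families

/-! ### Families of l-prime ideals are ultraclosed. -/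

section LPrime

variable {X : Type*} (add mul : X → X → X)

/-- Each condition is a Boolean relation between finitely many memberships, and ultrafilters commute
with "and" and "or". -/
theorem isUltraClosed_lPrimeIdeals : IsUltraClosed (lPrimeIdeals add mul) := by
  intro F hF
  refine ⟨fun x y => ?_, fun x y => ?_⟩
  · refine Iff.trans ?_ Filter.inter_mem_iff
    refine Filter.congr_sets (Filter.mem_of_superset hF fun p hp => hp.1 x y)
  · refine Iff.trans ?_ Ultrafilter.union_mem_iff
    refine Filter.congr_sets (Filter.mem_of_superset hF fun p hp => hp.2 x y)

theorem isUltraClosed_properLPrimeIdeals (ξ₀ ξ₁ : X) :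
    IsUltraClosed (properLPrimeIdeals add mul ξ₀ ξ₁) := by
  intro F hF
  refine ⟨isUltraClosed_lPrimeIdeals add mul F (Filter.mem_of_superset hF fun p hp => hp.1),
    Filter.mem_of_superset hF fun p hp => hp.2.1, ?_⟩
  exact Ultrafilter.compl_mem_iff_notMem.1 (Filter.mem_of_superset hF fun p hp => hp.2.2)

end LPrime

/-! ### Prime ideals of a distributive lattice. -/

section Spec

variable {L : Type*} [DistribLattice L] [BoundedOrder L]

/-- Prime ideals of a lattice are its proper l-prime ideals. -/
theorem spec_eq_properLPrimeIdeals :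
    spec L = properLPrimeIdeals (· ⊔ ·) (· ⊓ ·) (⊥ : L) ⊤ := by
  ext q
  constructor
  · rintro ⟨I, hI, rfl⟩
    refine ⟨⟨fun x y => I.sup_mem_iff, fun x y => ⟨hI.mem_or_mem, ?_⟩⟩, I.bot_mem, ?_⟩
    · rintro (h | h)
      · exact I.lower inf_le_left h
      · exact I.lower inf_le_right h
    · exact hI.toIsProper.top_notMem
  · rintro ⟨⟨hsup, hinf⟩, hbot, htop⟩
    let I : Order.Ideal L :=
      { carrier := q
        lower' := fun a b hba ha => by
          have := (hsup b a).1 (by simpa [sup_eq_right.2 hba] using ha)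
          exact this.1
        nonempty' := ⟨⊥, hbot⟩
        directed' := fun a ha b hb => ⟨a ⊔ b, (hsup a b).2 ⟨ha, hb⟩, le_sup_left, le_sup_right⟩ }
    have hI : I.IsProper := Order.Ideal.isProper_of_notMem (p := ⊤) htop
    exact ⟨I, Order.Ideal.IsPrime.of_mem_or_mem fun {x y} h => (hinf x y).1 h, rfl⟩

theorem isUltraClosed_spec : IsUltraClosed (spec L) :=
  spec_eq_properLPrimeIdeals (L := L) ▸ isUltraClosed_properLPrimeIdeals _ _ _ _

theorem sup_mem_spec {q : Set L} (hq : q ∈ spec L) {a b : L} : a ⊔ b ∈ q ↔ a ∈ q ∧ b ∈ q :=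
  (spec_eq_properLPrimeIdeals (L := L) ▸ hq).1.1 a b

theorem inf_mem_spec {q : Set L} (hq : q ∈ spec L) {a b : L} : a ⊓ b ∈ q ↔ a ∈ q ∨ b ∈ q :=
  (spec_eq_properLPrimeIdeals (L := L) ▸ hq).1.2 a b

theorem bot_mem_spec {q : Set L} (hq : q ∈ spec L) : ⊥ ∈ q :=
  (spec_eq_properLPrimeIdeals (L := L) ▸ hq).2.1

theorem top_notMem_spec {q : Set L} (hq : q ∈ spec L) : ⊤ ∉ q :=
  (spec_eq_properLPrimeIdeals (L := L) ▸ hq).2.2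

/-- If `a ≰ b`, the filter above `a` is disjoint from the ideal below `b`, and the prime ideal
theorem separates them. -/
theorem le_of_forall_spec {a b : L} (h : ∀ q ∈ spec L, b ∈ q → a ∈ q) : a ≤ b := by
  by_contra hab
  have hd : Disjoint (Order.PFilter.principal a : Set L) (Order.Ideal.principal b : Set L) :=
    Set.disjoint_left.2 fun c hac hcb => hab
      ((Order.PFilter.mem_principal.1 hac).trans (Order.Ideal.mem_principal.1 hcb))
  obtain ⟨J, hJ, hbJ, hdJ⟩ := DistribLattice.prime_ideal_of_disjoint_filter_ideal hd
  refine Set.disjoint_left.1 hdJ (Order.PFilter.mem_principal.2 le_rfl) ?_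
  exact h _ ⟨J, hJ, rfl⟩ (hbJ (Order.Ideal.mem_principal.2 le_rfl))

theorem eq_of_forall_spec {a b : L} (h : ∀ q ∈ spec L, a ∈ q ↔ b ∈ q) : a = b :=
  le_antisymm (le_of_forall_spec fun q hq => (h q hq).2) (le_of_forall_spec fun q hq => (h q hq).1)

/-- Lattice homomorphisms that agree on a generating set are equal. -/
theorem Generates.hom_ext {A : Set L} (hA : Generates A) {M F : Type*} [DistribLattice M]
    [BoundedOrder M] [FunLike F L M] [BoundedLatticeHomClass F L M] {f g : F}
    (h : Set.EqOn f g A) : f = g := by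
  let E : Sublattice L :=
    { carrier := {a | f a = g a}
      supClosed' := fun a ha b hb => by
        simp only [Set.mem_ofPred_eq] at *
        rw [map_sup, map_sup, ha, hb]
      infClosed' := fun a ha b hb => by
        simp only [Set.mem_ofPred_eq] at *
        rw [map_inf, map_inf, ha, hb] }
  have hE : E = ⊤ := hA E h (by change f ⊥ = g ⊥; simp) (by change f ⊤ = g ⊤; simp)
  exact DFunLike.ext _ _ fun a => (hE ▸ Sublattice.mem_top a : a ∈ E)

end Spec

/-! ### Spectrum and universal property of the generated lattice. -/

section Universal

variable {X : Type*} {S : Set (Set X)} {L : Type*} [DistribLattice L] [BoundedOrder L]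

/-- The prime ideal of `basicLattice S` given by a point of `S`. -/
def pointIdeal (p : S) : spec (basicLattice S) :=
  ⟨{a | p ∉ (a : Set S)}, spec_eq_properLPrimeIdeals (L := basicLattice S) ▸
    ⟨⟨fun _ _ => not_or, fun _ _ => not_and_or⟩, fun h => h, fun h => h trivial⟩⟩

theorem isSpectralIso_pullback_toBasicLattice
    (h : ∀ q ∈ spec (basicLattice S), toBasicLattice S ⁻¹' q ∈ S) :
    IsSpectralIso (familyBitopology (spec (basicLattice S))) (familyBitopology S)
      (pullback (toBasicLattice S) h) := by
  have hright : Function.RightInverse (pointIdeal (S := S)) (pullback (toBasicLattice S) h) :=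
    fun p => Subtype.ext (Set.ext fun x => not_not)
  have hinj : Function.Injective (pullback (toBasicLattice S) h) := by
    intro q r hqr
    refine Subtype.ext (Set.ext fun a => ?_)
    obtain ⟨a, ha⟩ := a
    change IsGenerated S a at ha
    induction ha with
    | basic x => exact Set.ext_iff.1 (congrArg Subtype.val hqr) x
    | bot => exact iff_of_true (bot_mem_spec q.2) (bot_mem_spec r.2)
    | top => exact iff_of_false (top_notMem_spec q.2) (top_notMem_spec r.2)
    | sup ha hb iha ihb =>
      exact (sup_mem_spec q.2 (a := ⟨_, ha⟩) (b := ⟨_, hb⟩)).trans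
        ((and_congr iha ihb).trans (sup_mem_spec r.2 (a := ⟨_, ha⟩) (b := ⟨_, hb⟩)).symm)
    | inf ha hb iha ihb =>
      exact (inf_mem_spec q.2 (a := ⟨_, ha⟩) (b := ⟨_, hb⟩)).trans
        ((or_congr iha ihb).trans (inf_mem_spec r.2 (a := ⟨_, ha⟩) (b := ⟨_, hb⟩)).symm)
  refine ⟨⟨?_, ?_⟩, pointIdeal, ⟨?_, ?_⟩, hright.leftInverse_of_injective hinj, hright⟩
  · refine continuous_generateFrom_iff.2 ?_
    rintro _ ⟨x, rfl⟩
    exact TopologicalSpace.isOpen_generateFrom_of_mem ⟨toBasicLattice S x, rfl⟩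
  · refine continuous_generateFrom_iff.2 ?_
    rintro _ ⟨x, rfl⟩
    exact TopologicalSpace.isOpen_generateFrom_of_mem ⟨toBasicLattice S x, rfl⟩
  · refine continuous_generateFrom_iff.2 ?_
    rintro _ ⟨a, rfl⟩
    -- The preimage of `{q | a ∉ q}` under `pointIdeal` is `a` itself.
    convert IsGenerated.isOpen_pos a.2 using 1
    ext p
    exact not_not
  · refine continuous_generateFrom_iff.2 ?_
    rintro _ ⟨a, rfl⟩
    exact IsGenerated.isOpen_neg_compl a.2

/-- Induction on how `a` is generated. Different derivations cannot conflict, because `b` is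
determined by the prime ideals containing it; hence a choice of `b` is automatically a homomorphism
in `a`. -/
theorem exists_mem_iff_pullback_notMem (θ : X → L) (h : ∀ q ∈ spec L, θ ⁻¹' q ∈ S)
    (a : basicLattice S) : ∃ b : L, ∀ q : spec L, b ∈ (q : Set L) ↔ pullback θ h q ∉ (a : Set S) := by
  obtain ⟨a, ha⟩ := a
  change IsGenerated S a at ha
  induction ha with
  | basic x => exact ⟨θ x, fun q => not_not.symm⟩
  | bot => exact ⟨⊥, fun q => iff_of_true (bot_mem_spec q.2) fun h => h⟩
  | top => exact ⟨⊤, fun q => iff_of_false (top_notMem_spec q.2) fun h => h trivial⟩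
  | sup _ _ iha ihb =>
    obtain ⟨b, hb⟩ := iha
    obtain ⟨c, hc⟩ := ihb
    exact ⟨b ⊔ c, fun q => (sup_mem_spec q.2).trans ((and_congr (hb q) (hc q)).trans not_or.symm)⟩
  | inf _ _ iha ihb =>
    obtain ⟨b, hb⟩ := iha
    obtain ⟨c, hc⟩ := ihb
    exact ⟨b ⊓ c,
      fun q => (inf_mem_spec q.2).trans ((or_congr (hb q) (hc q)).trans not_and_or.symm)⟩

theorem exists_hom_mem_iff (θ : X → L) (h : ∀ q ∈ spec L, θ ⁻¹' q ∈ S) :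
    ∃ l : BoundedLatticeHom (basicLattice S) L, ⇑l ∘ toBasicLattice S = θ ∧
      ∀ a (q : spec L), l a ∈ (q : Set L) ↔ pullback θ h q ∉ (a : Set S) := by
  choose l hl using exists_mem_iff_pullback_notMem θ h
  refine ⟨{ toFun := l, map_sup' := ?_, map_inf' := ?_, map_top' := ?_, map_bot' := ?_ }, ?_, hl⟩
  · exact fun a b => eq_of_forall_spec fun q hq => (hl _ ⟨q, hq⟩).trans
      (not_or.trans ((and_congr (hl a ⟨q, hq⟩) (hl b ⟨q, hq⟩)).symm.trans (sup_mem_spec hq).symm))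
  · exact fun a b => eq_of_forall_spec fun q hq => (hl _ ⟨q, hq⟩).trans
      (not_and_or.trans
        ((or_congr (hl a ⟨q, hq⟩) (hl b ⟨q, hq⟩)).symm.trans (inf_mem_spec hq).symm))
  · exact eq_of_forall_spec fun q hq => (hl _ ⟨q, hq⟩).trans
      (iff_of_false (fun h => h trivial) (top_notMem_spec hq))
  · exact eq_of_forall_spec fun q hq => (hl _ ⟨q, hq⟩).trans
      (iff_of_true (fun h => h) (bot_mem_spec hq))
  · exact funext fun x => eq_of_forall_spec fun q hq => (hl _ ⟨q, hq⟩).trans not_not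

theorem existsUnique_hom (θ : X → L) (h : ∀ q ∈ spec L, θ ⁻¹' q ∈ S) :
    ∃! l : BoundedLatticeHom (basicLattice S) L, ⇑l ∘ toBasicLattice S = θ := by
  obtain ⟨l, hl, -⟩ := exists_hom_mem_iff θ h
  refine ⟨l, hl, fun m hm => (generates_range_toBasicLattice S).hom_ext ?_⟩
  rintro _ ⟨x, rfl⟩
  exact congrFun (hm.trans hl.symm) x

theorem IsUltraClosed.existsUnique_orderIso (hS : IsUltraClosed S) (θ : X → L)
    (h : ∀ q ∈ spec L, θ ⁻¹' q ∈ S)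
    (hθ : IsSpectralIso (familyBitopology (spec L)) (familyBitopology S) (pullback θ h)) :
    ∃! l : basicLattice S ≃o L, ⇑l ∘ toBasicLattice S = θ := by
  obtain ⟨l, hl, hmem⟩ := exists_hom_mem_iff θ h
  obtain ⟨-, g, ⟨hpos, hneg⟩, hleft, hright⟩ := hθ
  have hle : ∀ {a b}, l a ≤ l b ↔ a ≤ b := by
    -- A point `p` of `a` outside `b` would give a prime ideal `g p` containing `l b` but not `l a`.
    refine fun {a b} => ⟨fun hab p hp => by_contra fun hpb => ?_, fun hab => OrderHomClass.mono l hab⟩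
    have hb := (hmem b (g p)).2 (by rwa [hright p])
    have hab' : l a ⊔ l b ∈ (g p : Set L) := by rwa [sup_eq_right.2 hab]
    have ha := (hmem a (g p)).1 ((sup_mem_spec (g p).2).1 hab').1
    rw [hright p] at ha
    exact ha hp
  have hsurj : Function.Surjective l := by
    intro c
    -- The preimage of `c` under `l`: bicontinuity of `g` puts this set in `ℒ⁺`, so compactness
    -- makes it a member of the generated lattice.
    have hU : IsGenerated S {p | c ∉ (g p : Set L)} := hS.isGenerated
      ⟨continuous_def.1 hpos _ (IsGenerated.basic (S := spec L) c).isOpen_pos,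
        continuous_def.1 hneg _ (IsGenerated.basic (S := spec L) c).isOpen_neg_compl⟩
    refine ⟨⟨_, hU⟩, eq_of_forall_spec fun q hq => (hmem _ ⟨q, hq⟩).trans (not_not.trans ?_)⟩
    rw [hleft ⟨q, hq⟩]
  refine ⟨RelIso.ofSurjective (OrderEmbedding.ofMapLEIff l fun _ _ => hle) hsurj, hl,
    fun m hm => (generates_range_toBasicLattice S).hom_ext ?_⟩
  rintro _ ⟨x, rfl⟩
  exact congrFun (hm.trans hl.symm) x

end Universal

end AbstractSpectra

/-! ### The main theorem. -/

theorem corollary2p4p3 {X : Type u} (add mul : X → X → X) (ξ₀ ξ₁ : X) (hξ : ξ₀ ≠ ξ₁)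
    (S : Set (Set X))
    (hS : S = lPrimeIdeals add mul ∨ S = properLPrimeIdeals add mul ξ₀ ξ₁) :
    ∃ (L : Type u) (_ : DistribLattice L) (_ : BoundedOrder L) (φ : X → L),
      -- the two spaces below are objects of the category of abstract spectra (unless empty)
      (S.Nonempty → IsAbstractSpectrum (familyBitopology S) ∧
        IsAbstractSpectrum (familyBitopology (spec L))) ∧
      -- (i)
      Generates (Set.range φ) ∧
      -- (ii) and (iii)
      (∃ h : ∀ q ∈ spec L, φ ⁻¹' q ∈ S,
        IsSpectralIso (familyBitopology (spec L)) (familyBitopology S) (pullback φ h)) ∧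
      -- (iv)
      (∀ (L' : Type v) [DistribLattice L'] [BoundedOrder L'] (θ : X → L')
        (h : ∀ q ∈ spec L', θ ⁻¹' q ∈ S),
        IsSpectralMorphism (familyBitopology (spec L')) (familyBitopology S) (pullback θ h) →
        ∃! l : BoundedLatticeHom L L', ⇑l ∘ φ = θ) ∧
      -- (v)
      (∀ (L₁ : Type v) [DistribLattice L₁] [BoundedOrder L₁] (φ₁ : X → L₁)
        (h : ∀ q ∈ spec L₁, φ₁ ⁻¹' q ∈ S),
        IsSpectralIso (familyBitopology (spec L₁)) (familyBitopology S) (pullback φ₁ h) →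
        ∃! l : L ≃o L₁, ⇑l ∘ φ = φ₁) ∧
      -- (vi)
      (∀ a b : X, φ (add a b) = φ a ⊔ φ b ∧ φ (mul a b) = φ a ⊓ φ b) := by
  have hS' : IsUltraClosed S := by
    rcases hS with rfl | rfl
    · exact isUltraClosed_lPrimeIdeals add mul
    · exact isUltraClosed_properLPrimeIdeals add mul ξ₀ ξ₁
  have hprime : S ⊆ lPrimeIdeals add mul := by
    rcases hS with rfl | rfl
    · exact subset_rfl
    · exact fun p hp => hp.1
  -- Basic sets record non-membership, so by De Morgan the "and" in the rule for `add` becomes a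
  -- union and the "or" for `mul` an intersection.
  have hvi : ∀ a b : X,
      toBasicLattice S (add a b) = toBasicLattice S a ⊔ toBasicLattice S b ∧
      toBasicLattice S (mul a b) = toBasicLattice S a ⊓ toBasicLattice S b := fun a b =>
    ⟨Subtype.ext (Set.ext fun p => (not_congr ((hprime p.2).1 a b)).trans not_and_or),
      Subtype.ext (Set.ext fun p => (not_congr ((hprime p.2).2 a b)).trans not_or)⟩
  have hii : ∀ q ∈ spec (basicLattice S), toBasicLattice S ⁻¹' q ∈ S := by
    intro q hq
    have hq' : toBasicLattice S ⁻¹' q ∈ lPrimeIdeals add mul :=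
      ⟨fun x y => by simpa only [Set.mem_preimage, (hvi x y).1] using sup_mem_spec hq,
        fun x y => by simpa only [Set.mem_preimage, (hvi x y).2] using inf_mem_spec hq⟩
    rcases hS with rfl | rfl
    · exact hq'
    -- Properness of the points of `S` makes the basic set of `ξ₀` empty and that of `ξ₁` all of
    -- `S`, so properness of `q` pulls back.
    · have h₀ : toBasicLattice (properLPrimeIdeals add mul ξ₀ ξ₁) ξ₀ = ⊥ :=
        Subtype.ext (Set.ext fun p => iff_of_false (fun h => h p.2.2.1) fun h => h)
      have h₁ : toBasicLattice (properLPrimeIdeals add mul ξ₀ ξ₁) ξ₁ = ⊤ :=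
        Subtype.ext (Set.ext fun p => iff_of_true p.2.2.2 trivial)
      exact ⟨hq', Set.mem_preimage.2 (h₀ ▸ bot_mem_spec hq),
        fun h => top_notMem_spec hq (h₁ ▸ Set.mem_preimage.1 h)⟩
  refine ⟨basicLattice S, inferInstance, inferInstance, toBasicLattice S, fun hne => ?_,
    generates_range_toBasicLattice S, ⟨hii, isSpectralIso_pullback_toBasicLattice hii⟩,
    fun L' _ _ θ h _ => existsUnique_hom θ h,
    fun L₁ _ _ φ₁ h hφ => hS'.existsUnique_orderIso φ₁ h hφ, hvi⟩
  obtain ⟨p, hp⟩ := hne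
  exact ⟨hS'.isAbstractSpectrum ⟨p, hp⟩,
    isUltraClosed_spec.isAbstractSpectrum ⟨_, (pointIdeal ⟨p, hp⟩).2⟩⟩
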